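/- Let $F$ be a field of characteristic different from $2$. A (not necessarily associative or unital) $F$-algebra $A$ is a Novikov algebra if $(x,y,z)=(y,x,z)$ and $(xy)z=(xz)y$ for all $x,y,z\in A$, where $(x,y,z)=(xy)z-x(yz)$. Put $A^{(0)_L}=A$ and let $A^{(n+1)_L}=[A^{(n)_L},A^{(n)_L}]$ be the subspace spanned by all commutators $[a,b]=ab-ba$ with $a,b\in A^{(n)_L}$; $A$ is Lie-solvable if $A^{(n)_L}=0$ for some $n\ge 0$. For $x\in A$ let $x^1=x$ and $x^n=x^{n-1}x$ for $n>1$. An ideal $I$ (a subspace closed under left and right multiplication by elements of the algebra) is trivial if $xy=0$ for all $x,y\in I$. Let $\mathcal B_0(A)=0$; for every ordinal $\alpha$ let $\mathcal B_{\alpha+1}(A)$ be the preimage in $A$ of the sum of all trivial ideals of $A/\mathcal B_\alpha(A)$; and let $\mathcal B_\alpha(A)=\bigcup_{\beta<\alpha}\mathcal B_\beta(A)$ for limit ordinals $\alpha$. The Baer radical of $A$ is $\mathcal B(A)=\mathcal B_\delta(A)$, where $\delta$ is an ordinal of cardinality greater than $|A|$. If $A$ is a Lie-solvable Novikov algebra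 over $F$, then \[\mathcal B(A)=\{x\in A \mid x^n=0 \text{ for some integer } n\ge 1\}.\] -/

import Mathlib

/-- A (not necessarily associative, not necessarily unital) algebra is a Novikov algebra if
`(x, y, z) = (y, x, z)` and `(x y) z = (x z) y`, where `(x, y, z) = (x y) z - x (y z)`. -/
structure IsNovikov (A : Type*) [NonUnitalNonAssocRing A] : Prop where
  left_symm : ∀ x y z : A, associator x y z = associator y x z
  right_comm : ∀ x y z : A, (x * y) * z = (x * z) * y

namespace NonAssocAlg

section Powers

/-- The left-normed power: `x ^ 1 = x` and `x ^ n = x ^ (n - 1) * x` for `n > 1`.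
The exponent `0` is meaningless and never used. -/
def leftPow {A : Type*} [Mul A] (x : A) : ℕ → A
  | 0 => x
  | 1 => x
  | n + 2 => leftPow x (n + 1) * x

end Powers

section LieSolvable

/-- The series `A₀ = A`, `Aₙ₊₁ = [Aₙ, Aₙ]`, where `[I, I]` is the subspace generated
by all commutators of elements of `I`. -/
def lieSeries (F : Type*) (A : Type*) [Field F] [NonUnitalNonAssocRing A] [Module F A] :
    ℕ → Submodule F A
  | 0 => ⊤
  | n + 1 => Submodule.span F
      {z | ∃ x ∈ lieSeries F A n, ∃ y ∈ lieSeries F A n, z = x * y - y * x}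

/-- `A` is Lie-solvable if its Lie-solvable series reaches zero. -/
def IsLieSolvable (F : Type*) (A : Type*) [Field F] [NonUnitalNonAssocRing A] [Module F A] :
    Prop :=
  ∃ n : ℕ, lieSeries F A n = ⊥

end LieSolvable

/-- A (two-sided) ideal of an `F`-algebra: a subspace closed under left and right
multiplication by elements of the algebra. -/
structure AlgIdeal (F : Type*) (A : Type*) [Field F] [NonUnitalNonAssocRing A] [Module F A]
    extends Submodule F A where
  mul_mem_left : ∀ (a : A) {x : A}, x ∈ toSubmodule → a * x ∈ toSubmodule
  mul_mem_right : ∀ (a : A) {x : A}, x ∈ toSubmodule → x * a ∈ toSubmodule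

namespace AlgIdeal

section Basic

variable {F : Type*} {A : Type*} [Field F] [NonUnitalNonAssocRing A] [Module F A]

/-- An ideal is trivial if it has zero multiplication. -/
def IsTrivial (I : AlgIdeal F A) : Prop :=
  ∀ x ∈ I.toSubmodule, ∀ y ∈ I.toSubmodule, x * y = 0

/-- The zero ideal. -/
def zero (F : Type*) (A : Type*) [Field F] [NonUnitalNonAssocRing A] [Module F A] :
    AlgIdeal F A where
  toSubmodule := ⊥
  mul_mem_left a x hx := by
    rw [Submodule.mem_bot] at hx ⊢
    rw [hx, mul_zero]
  mul_mem_right a x hx := by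
    rw [Submodule.mem_bot] at hx ⊢
    rw [hx, zero_mul]

/-- The sum of a set of ideals. -/
def sum (S : Set (AlgIdeal F A)) : AlgIdeal F A where
  toSubmodule := ⨆ I : S, (I : AlgIdeal F A).toSubmodule
  mul_mem_left a x hx := by
    refine Submodule.iSup_induction (fun I : S => (I : AlgIdeal F A).toSubmodule)
      (motive := fun x => a * x ∈ ⨆ I : S, (I : AlgIdeal F A).toSubmodule) hx ?_ ?_ ?_
    · intro I x hx
      exact Submodule.mem_iSup_of_mem I ((I : AlgIdeal F A).mul_mem_left a hx)
    · rw [mul_zero]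
      exact Submodule.zero_mem _
    · intro x y hx hy
      rw [mul_add]
      exact Submodule.add_mem _ hx hy
  mul_mem_right a x hx := by
    refine Submodule.iSup_induction (fun I : S => (I : AlgIdeal F A).toSubmodule)
      (motive := fun x => x * a ∈ ⨆ I : S, (I : AlgIdeal F A).toSubmodule) hx ?_ ?_ ?_
    · intro I x hx
      exact Submodule.mem_iSup_of_mem I ((I : AlgIdeal F A).mul_mem_right a hx)
    · rw [zero_mul]
      exact Submodule.zero_mem _
    · intro x y hx hy
      rw [add_mul]
      exact Submodule.add_mem _ hx hy

/-- `sumTrivial F A` is the sum of all trivial ideals of `A`. -/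
def sumTrivial (F : Type*) (A : Type*) [Field F] [NonUnitalNonAssocRing A] [Module F A] :
    AlgIdeal F A :=
  sum {I | I.IsTrivial}

end Basic

section Quotient

variable {F : Type*} {A : Type*} [Field F] [NonUnitalNonAssocRing A] [Module F A]

/-- The multiplication `(a + I) (b + I) = a b + I` on the quotient space `A / I`. -/
instance quotientMul (I : AlgIdeal F A) : Mul (A ⧸ I.toSubmodule) where
  mul := Quotient.map₂ (fun a b => a * b) (by
    intro a a' ha b b' hb
    replace ha := (Submodule.quotientRel_def _).1 ha
    replace hb := (Submodule.quotientRel_def _).1 hb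
    refine (Submodule.quotientRel_def _).2 ?_
    have h : a * b - a' * b' = (a - a') * b + a' * (b - b') := by
      rw [sub_mul, mul_sub, sub_add_sub_cancel]
    rw [h]
    exact I.toSubmodule.add_mem (I.mul_mem_right b ha) (I.mul_mem_left a' hb))

theorem mk_mul (I : AlgIdeal F A) (a b : A) :
    (Submodule.Quotient.mk (a * b) : A ⧸ I.toSubmodule) =
      Submodule.Quotient.mk a * Submodule.Quotient.mk b := rfl

/-- The quotient of an algebra by an ideal; its additive group and `F`-module structure are
those of the quotient space. -/
instance quotientRing (I : AlgIdeal F A) : NonUnitalNonAssocRing (A ⧸ I.toSubmodule) where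
  __ := Submodule.Quotient.addCommGroup I.toSubmodule
  __ := quotientMul I
  left_distrib := by
    intro x y z
    induction x using Submodule.Quotient.induction_on with | _ a
    induction y using Submodule.Quotient.induction_on with | _ b
    induction z using Submodule.Quotient.induction_on with | _ c
    exact congrArg Submodule.Quotient.mk (mul_add a b c)
  right_distrib := by
    intro x y z
    induction x using Submodule.Quotient.induction_on with | _ a
    induction y using Submodule.Quotient.induction_on with | _ b
    induction z using Submodule.Quotient.induction_on with | _ c
    exact congrArg Submodule.Quotient.mk (add_mul a b c)
  zero_mul := by
    intro x
    induction x using Submodule.Quotient.induction_on with | _ a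
    exact congrArg Submodule.Quotient.mk (zero_mul a)
  mul_zero := by
    intro x
    induction x using Submodule.Quotient.induction_on with | _ a
    exact congrArg Submodule.Quotient.mk (mul_zero a)

/-- The preimage in `A` of an ideal of `A / I` under the canonical projection. -/
def preimage (I : AlgIdeal F A) (J : AlgIdeal F (A ⧸ I.toSubmodule)) : AlgIdeal F A where
  toSubmodule := J.toSubmodule.comap I.toSubmodule.mkQ
  mul_mem_left a _ hx := J.mul_mem_left (Submodule.Quotient.mk a) hx
  mul_mem_right a _ hx := J.mul_mem_right (Submodule.Quotient.mk a) hx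

theorem le_preimage (I : AlgIdeal F A) (J : AlgIdeal F (A ⧸ I.toSubmodule)) :
    I.toSubmodule ≤ (preimage I J).toSubmodule := by
  intro x hx
  have h : I.toSubmodule.mkQ x = 0 := (Submodule.Quotient.mk_eq_zero _).2 hx
  change I.toSubmodule.mkQ x ∈ J.toSubmodule
  rw [h]
  exact Submodule.zero_mem _

end Quotient

end AlgIdeal

section Baer

universe u v

variable (F : Type u) (A : Type v) [Field F] [NonUnitalNonAssocRing A] [Module F A]

/-- The transfinite Baer series: `B₀ = 0`, `B_{α+1}` is the preimage in `A` of the sum of all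
trivial ideals of `A / B_α`, and at a limit `α` the ideal `B_α` is the sum of the `B_β`, `β < α`.
The series is increasing, so that this sum is the union (`mem_baerSeries_limit`). -/
noncomputable def baerSeries (α : Ordinal.{v}) : AlgIdeal F A :=
  Ordinal.limitRecOn (motive := fun _ => AlgIdeal F A) α
    (AlgIdeal.zero F A)
    (fun _ I => I.preimage (AlgIdeal.sumTrivial F (A ⧸ I.toSubmodule)))
    (fun α _ B => AlgIdeal.sum {I | ∃ β : Ordinal.{v}, ∃ hβ : β < α, I = B β hβ})

theorem baerSeries_zero : baerSeries F A 0 = AlgIdeal.zero F A :=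
  Ordinal.limitRecOn_zero _ _ _

theorem baerSeries_add_one (α : Ordinal.{v}) :
    baerSeries F A (α + 1) = (baerSeries F A α).preimage
      (AlgIdeal.sumTrivial F (A ⧸ (baerSeries F A α).toSubmodule)) :=
  Ordinal.limitRecOn_add_one _ _ _ _

theorem baerSeries_limit (α : Ordinal.{v}) (hα : Order.IsSuccLimit α) :
    baerSeries F A α = AlgIdeal.sum {I | ∃ β : Ordinal.{v}, ∃ _ : β < α, I = baerSeries F A β} :=
  Ordinal.limitRecOn_limit _ _ _ _ hα

theorem baerSeries_mono {β α : Ordinal.{v}} (h : β ≤ α) :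
    (baerSeries F A β).toSubmodule ≤ (baerSeries F A α).toSubmodule := by
  induction α using Ordinal.limitRecOn with
  | zero =>
    rw [nonpos_iff_eq_zero.1 h]
  | add_one α ih =>
    rcases h.lt_or_eq with h | rfl
    · refine (ih (Order.lt_add_one_iff.1 h)).trans ?_
      rw [baerSeries_add_one]
      exact AlgIdeal.le_preimage _ _
    · exact le_rfl
  | limit α hα _ =>
    rcases h.lt_or_eq with h | rfl
    · rw [baerSeries_limit F A α hα]
      exact le_iSup (fun I : {I | ∃ β : Ordinal.{v}, ∃ _ : β < α, I = baerSeries F A β} =>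
        (I : AlgIdeal F A).toSubmodule) ⟨baerSeries F A β, β, h, rfl⟩
    · exact le_rfl

/-- At a limit ordinal, the Baer series is the union of its previous members. -/
theorem mem_baerSeries_limit (α : Ordinal.{v}) (hα : Order.IsSuccLimit α) (x : A) :
    x ∈ (baerSeries F A α).toSubmodule ↔
      ∃ β : Ordinal.{v}, β < α ∧ x ∈ (baerSeries F A β).toSubmodule := by
  constructor
  · intro hx
    rw [baerSeries_limit F A α hα] at hx
    have : Nonempty {I | ∃ β : Ordinal.{v}, ∃ _ : β < α, I = baerSeries F A β} :=
      ⟨⟨baerSeries F A 0, 0, hα.bot_lt, rfl⟩⟩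
    obtain ⟨⟨_, β, hβ, rfl⟩, h⟩ := (Submodule.mem_iSup_of_directed
      (fun I : {I | ∃ β : Ordinal.{v}, ∃ _ : β < α, I = baerSeries F A β} =>
        (I : AlgIdeal F A).toSubmodule) (by
      rintro ⟨_, β, hβ, rfl⟩ ⟨_, γ, hγ, rfl⟩
      exact ⟨⟨baerSeries F A (max β γ), max β γ, max_lt hβ hγ, rfl⟩,
        baerSeries_mono F A (le_max_left β γ), baerSeries_mono F A (le_max_right β γ)⟩)).1 hx
    exact ⟨β, hβ, h⟩
  · rintro ⟨β, hβ, h⟩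
    exact baerSeries_mono F A hβ.le h

/-- The Baer radical `B(A) = B_δ`, where `δ` is the least ordinal whose cardinality is greater
than that of `A` (every further member of the series is then the same). -/
noncomputable def baerRadical : AlgIdeal F A :=
  baerSeries F A (Order.succ (Cardinal.mk A)).ord

end Baer

end NonAssocAlg

/-! Write `R` for right multiplication by `x`. Elements of the radical are nilpotent because, in any
Novikov algebra, a power of `x` in an ideal `I` forces a higher power into `I * I`
(`leftPow_mem_of_mul_mem`). Thus trivial ideals can be peeled off one at a time, and transfinite
induction descends the Baer series.

Conversely, the radical `B` is semiprime, by a cardinality argument. Characteristic not 2 makes the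
terms of the Lie series ideals. An ideal `K` inside `[A, A]` that is commutative modulo `B`
satisfies `(K * K) * K ⊆ B`, hence `K ⊆ B`; climbing the series from its zero term gives `[A, A] ⊆
B`. Modulo `B` the algebra is then commutative, and semiprimeness excludes nonzero nilpotents. -/

namespace IsNovikov

variable {A : Type*} [NonUnitalNonAssocRing A]

/-! ### Identities in Novikov algebras. -/

theorem mul_sub_mul_eq (hA : IsNovikov A) (x y z : A) :
    x * (y * z) - y * (x * z) = (x * y - y * x) * z := by
  have h := hA.left_symm x y z
  simp only [associator_apply] at h
  rw [sub_mul, sub_eq_sub_iff_add_eq_add]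
  rw [sub_eq_sub_iff_add_eq_add] at h
  rw [add_comm, h, add_comm]

/-- Right multiplications commute, so the factor `y` passes to the far right of both terms of the
associator. -/
theorem associator_mul (hA : IsNovikov A) (x y z w : A) :
    associator (x * y) z w = associator x z w * y := by
  simp only [associator_apply, sub_mul]
  rw [hA.right_comm x y z, hA.right_comm (x * z) y w, hA.right_comm x y (z * w)]

/-- Twice the product of a commutator with any element is a sum of commutators. -/
theorem commutator_mul_add_self (hA : IsNovikov A) (a b c : A) :
    (a * b - b * a) * c + (a * b - b * a) * c =
      ((a * c) * b - b * (a * c)) - ((b * c) * a - a * (b * c)) := by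
  nth_rw 1 [← hA.mul_sub_mul_eq a b c]
  rw [sub_mul, hA.right_comm a b c, hA.right_comm b a c]
  abel

/-- Novikov algebras are Lie-admissible. -/
theorem jacobi (hA : IsNovikov A) (a b c : A) :
    c * (a * b - b * a) - (a * b - b * a) * c =
      ((c * a - a * c) * b - b * (c * a - a * c)) +
        (a * (c * b - b * c) - (c * b - b * c) * a) := by
  rw [← hA.mul_sub_mul_eq a b c, ← hA.mul_sub_mul_eq c a b, ← hA.mul_sub_mul_eq c b a]
  simp only [mul_sub]
  abel

end IsNovikov

namespace NonAssocAlg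

/-! ### Powers of one element and products of powers. -/

section Powers

variable {A : Type*} [NonUnitalNonAssocRing A]

theorem leftPow_succ (x : A) {n : ℕ} (hn : 0 < n) : leftPow x (n + 1) = leftPow x n * x := by
  obtain ⟨n, rfl⟩ := Nat.exists_eq_succ_of_ne_zero hn.ne'
  rfl

/-- Iterated right multiplication by `x`. -/
def rightIter (x : A) (k : ℕ) (z : A) : A := (fun w => w * x)^[k] z

theorem rightIter_zero (x z : A) : rightIter x 0 z = z := rfl

theorem rightIter_succ (x : A) (k : ℕ) (z : A) : rightIter x (k + 1) z = rightIter x k z * x :=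
  Function.iterate_succ_apply' _ _ _

theorem rightIter_succ' (x : A) (k : ℕ) (z : A) : rightIter x (k + 1) z = rightIter x k (z * x) :=
  rfl

theorem rightIter_leftPow (x : A) {n : ℕ} (hn : 0 < n) (k : ℕ) :
    rightIter x k (leftPow x n) = leftPow x (n + k) := by
  induction k with
  | zero => rfl
  | succ k ih => rw [rightIter_succ, ih, ← leftPow_succ x (by omega), add_assoc]

/-- Left symmetry moves the power into the first slot, where `associator_mul` extracts its factors
one by one. -/
theorem associator_leftPow (hA : IsNovikov A) (x z : A) (k : ℕ) :
    associator z (leftPow x (k + 1)) x = rightIter x k (associator z x x) := by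
  induction k with
  | zero => rfl
  | succ k ih =>
    rw [leftPow_succ x k.succ_pos, hA.left_symm, hA.associator_mul, hA.left_symm, ih,
      rightIter_succ]

/-- Each reassociation of `z * (x ^ m * x)` costs one associator, and by `associator_leftPow` these
all accumulate as copies of a single term. -/
theorem mul_leftPow (hA : IsNovikov A) (x z : A) (k : ℕ) :
    z * leftPow x (k + 2) = rightIter x (k + 2) z - (k + 1) • rightIter x k (associator z x x) := by
  induction k with
  | zero =>
    rw [zero_add, zero_add, one_smul, rightIter_zero, associator_apply]
    exact (sub_sub_cancel (z * x * x) _).symm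
  | succ k ih =>
    have h := associator_leftPow hA x z (k + 1)
    rw [associator_apply, ih, sub_eq_iff_eq_add] at h
    have e : k + 1 + 2 = (k + 2) + 1 := rfl
    rw [e, leftPow_succ x (by omega), rightIter_succ x (k + 2), succ_nsmul, ← sub_sub,
      eq_sub_iff_add_eq, add_comm, ← h, sub_mul, smul_mul_assoc, ← rightIter_succ,
      ← rightIter_succ]

/-- If `x ^ n` lies in a subspace `I` closed under right multiplication by `x`, then
`x ^ (2 n + 1)` lies in the span of the products of elements of `I`. -/
theorem leftPow_mem_of_mul_mem (hA : IsNovikov A) (I M : AddSubgroup A) (x : A)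
    (hI : ∀ z ∈ I, z * x ∈ I) (hM : ∀ z ∈ I, ∀ w ∈ I, z * w ∈ M) (n : ℕ)
    (hx : leftPow x (n + 2) ∈ I) : leftPow x (2 * n + 5) ∈ M := by
  set z := leftPow x (n + 2) with hz
  -- Both products equal `R ^ (n + 3) z` minus, respectively, `n + 1` and `n + 2` copies of `R ^ (n
  -- + 1) (z, x, x)`. Their difference puts that term in `M`, hence also `R ^ (n + 3) z = x ^ (2 n +
  -- 5)`.
  have h1 : (z * x) * leftPow x (n + 2) ∈ M := hM _ (hI _ hx) _ hx
  have h2 : z * leftPow x (n + 1 + 2) ∈ M := by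
    refine hM _ hx _ ?_
    rw [show n + 1 + 2 = (n + 2) + 1 from rfl, leftPow_succ x (by omega)]
    exact hI _ hx
  rw [mul_leftPow hA, hA.associator_mul, ← rightIter_succ', ← rightIter_succ'] at h1
  rw [mul_leftPow hA, succ_nsmul, ← sub_sub] at h2
  have h3 := M.sub_mem h1 h2
  rw [show n + 1 + 2 = n + 2 + 1 from rfl, sub_sub_cancel] at h3
  have h4 := M.add_mem h1 (M.nsmul_mem h3 (n + 1))
  rw [sub_add_cancel, hz, rightIter_leftPow x (by omega)] at h4
  convert h4 using 2
  omega

end Powers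

namespace AlgIdeal

/-! ### Nilpotency in sums of trivial ideals. -/

variable {F : Type*} {A : Type*} [Field F] [NonUnitalNonAssocRing A] [Module F A]

theorem isNovikov_quotient (hA : IsNovikov A) (I : AlgIdeal F A) :
    IsNovikov (A ⧸ I.toSubmodule) where
  left_symm x y z := by
    induction x using Submodule.Quotient.induction_on with | _ a
    induction y using Submodule.Quotient.induction_on with | _ b
    induction z using Submodule.Quotient.induction_on with | _ c
    exact congrArg Submodule.Quotient.mk (hA.left_symm a b c)
  right_comm x y z := by
    induction x using Submodule.Quotient.induction_on with | _ a
    induction y using Submodule.Quotient.induction_on with | _ b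
    induction z using Submodule.Quotient.induction_on with | _ c
    exact congrArg Submodule.Quotient.mk (hA.right_comm a b c)

theorem mk_leftPow (I : AlgIdeal F A) (x : A) {n : ℕ} (hn : 0 < n) :
    (Submodule.Quotient.mk (leftPow x n) : A ⧸ I.toSubmodule) =
      leftPow (Submodule.Quotient.mk x) n := by
  induction n, hn using Nat.le_induction with
  | base => rfl
  | succ n hn ih => rw [leftPow_succ x hn, leftPow_succ _ hn, mk_mul, ih]

theorem leftPow_mem_of_le (I : AlgIdeal F A) (x : A) {n m : ℕ} (hn : 0 < n) (hnm : n ≤ m)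
    (hx : leftPow x n ∈ I.toSubmodule) : leftPow x m ∈ I.toSubmodule := by
  induction m, hnm using Nat.le_induction with
  | base => exact hx
  | succ m hm ih =>
    rw [leftPow_succ x (by omega)]
    exact I.mul_mem_right x ih

/-- The sum of two ideals. -/
def sup (I J : AlgIdeal F A) : AlgIdeal F A where
  toSubmodule := I.toSubmodule ⊔ J.toSubmodule
  mul_mem_left a x hx := by
    obtain ⟨y, hy, z, hz, rfl⟩ := Submodule.mem_sup.1 hx
    rw [mul_add]
    exact Submodule.add_mem_sup (I.mul_mem_left a hy) (J.mul_mem_left a hz)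
  mul_mem_right a x hx := by
    obtain ⟨y, hy, z, hz, rfl⟩ := Submodule.mem_sup.1 hx
    rw [add_mul]
    exact Submodule.add_mem_sup (I.mul_mem_right a hy) (J.mul_mem_right a hz)

/-- Since `I * I = 0`, products of two elements of `I + J` lie in `J`. -/
theorem exists_leftPow_mem_of_mem_sup (hA : IsNovikov A) (I J : AlgIdeal F A) (hI : I.IsTrivial)
    (x : A) {n : ℕ} (hn : 0 < n) (hx : leftPow x n ∈ (I.sup J).toSubmodule) :
    ∃ m, 0 < m ∧ leftPow x m ∈ J.toSubmodule := by
  refine ⟨2 * n + 5, by omega, leftPow_mem_of_mul_mem hA (I.sup J).toSubmodule.toAddSubgroup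
    J.toSubmodule.toAddSubgroup x (fun z hz => (I.sup J).mul_mem_right x hz) ?_ n
    (leftPow_mem_of_le _ x hn (by omega) hx)⟩
  intro z hz w hw
  obtain ⟨a, ha, b, hb, rfl⟩ := Submodule.mem_sup.1 hz
  obtain ⟨c, hc, d, hd, rfl⟩ := Submodule.mem_sup.1 hw
  rw [mul_add, add_mul, hI a ha c hc, zero_add]
  exact J.toSubmodule.add_mem (J.mul_mem_right c hb) (J.mul_mem_left _ hd)

theorem exists_leftPow_eq_zero_of_mem_sumTrivial (hA : IsNovikov A) (x : A) {n : ℕ} (hn : 0 < n)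
    (hx : leftPow x n ∈ (sumTrivial F A).toSubmodule) : ∃ m, 0 < m ∧ leftPow x m = 0 := by
  classical
  obtain ⟨s, hs⟩ := (Submodule.mem_iSup_iff_exists_finset
    (p := fun I : {I : AlgIdeal F A | I.IsTrivial} => (I : AlgIdeal F A).toSubmodule)).1 hx
  -- Membership involves only finitely many trivial ideals. The exponent is quantified inside
  -- because it grows as each one is removed.
  suffices h : ∃ J : AlgIdeal F A,
      J.toSubmodule = ⨆ I ∈ s, (I : AlgIdeal F A).toSubmodule ∧
        ∀ n, 0 < n → leftPow x n ∈ J.toSubmodule → ∃ m, 0 < m ∧ leftPow x m = 0 by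
    obtain ⟨J, hJ, h⟩ := h
    exact h n hn (hJ ▸ hs)
  clear hs hx hn
  induction s using Finset.induction_on with
  | empty =>
    refine ⟨zero F A, by simp [zero], fun n hn h => ⟨n, hn, h⟩⟩
  | insert I s _ ih =>
    obtain ⟨J, hJ, h⟩ := ih
    refine ⟨I.1.sup J, by rw [Finset.iSup_insert, ← hJ]; rfl, fun n hn hx => ?_⟩
    obtain ⟨m, hm, hm'⟩ := exists_leftPow_mem_of_mem_sup hA I.1 J I.2 x hn hx
    exact h m hm hm'

/-! ### Semiprime ideals and Lie-solvability. -/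

/-- The image of an ideal in a quotient algebra. -/
def map (B I : AlgIdeal F A) : AlgIdeal F (A ⧸ B.toSubmodule) where
  toSubmodule := I.toSubmodule.map B.toSubmodule.mkQ
  mul_mem_left a x hx := by
    obtain ⟨y, hy, rfl⟩ := hx
    induction a using Submodule.Quotient.induction_on with | _ a
    exact ⟨a * y, I.mul_mem_left a hy, rfl⟩
  mul_mem_right a x hx := by
    obtain ⟨y, hy, rfl⟩ := hx
    induction a using Submodule.Quotient.induction_on with | _ a
    exact ⟨y * a, I.mul_mem_right a hy, rfl⟩

theorem le_preimage_sumTrivial (B I : AlgIdeal F A)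
    (h : ∀ x ∈ I.toSubmodule, ∀ y ∈ I.toSubmodule, x * y ∈ B.toSubmodule) :
    I.toSubmodule ≤ (B.preimage (sumTrivial F (A ⧸ B.toSubmodule))).toSubmodule := by
  have ht : (map B I).IsTrivial := by
    rintro _ ⟨x, hx, rfl⟩ _ ⟨y, hy, rfl⟩
    exact (Submodule.Quotient.mk_eq_zero _).2 (h x hx y hy)
  intro x hx
  exact Submodule.mem_iSup_of_mem
    (p := fun I : {I : AlgIdeal F (A ⧸ B.toSubmodule) | I.IsTrivial} =>
      (I : AlgIdeal F (A ⧸ B.toSubmodule)).toSubmodule)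
    ⟨map B I, ht⟩ ⟨x, hx, rfl⟩

/-- An ideal `B` is semiprime if it contains every ideal whose square it contains. -/
def IsSemiprime (B : AlgIdeal F A) : Prop :=
  ∀ I : AlgIdeal F A, (∀ x ∈ I.toSubmodule, ∀ y ∈ I.toSubmodule, x * y ∈ B.toSubmodule) →
    I.toSubmodule ≤ B.toSubmodule

/-- In a Novikov algebra the square of an ideal is an ideal. -/
def square [IsScalarTower F A A] [SMulCommClass F A A] (hA : IsNovikov A) (I : AlgIdeal F A) :
    AlgIdeal F A where
  toSubmodule := Submodule.span F {z | ∃ x ∈ I.toSubmodule, ∃ y ∈ I.toSubmodule, z = x * y}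
  mul_mem_left a z hz := by
    refine Submodule.span_induction (p := fun z _ => a * z ∈ Submodule.span F _) ?_ ?_ ?_ ?_ hz
    · rintro _ ⟨x, hx, y, hy, rfl⟩
      -- `a (x y) = [a, x] y + x (a y)`.
      rw [← sub_add_cancel (a * (x * y)) (x * (a * y)), hA.mul_sub_mul_eq]
      exact Submodule.add_mem _
        (Submodule.subset_span ⟨_, I.toSubmodule.sub_mem (I.mul_mem_left a hx)
          (I.mul_mem_right a hx), y, hy, rfl⟩)
        (Submodule.subset_span ⟨x, hx, _, I.mul_mem_left a hy, rfl⟩)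
    · rw [mul_zero]
      exact Submodule.zero_mem _
    · intro x y _ _ hx hy
      rw [mul_add]
      exact Submodule.add_mem _ hx hy
    · intro c x _ hx
      rw [mul_smul_comm]
      exact Submodule.smul_mem _ c hx
  mul_mem_right a z hz := by
    refine Submodule.span_induction (p := fun z _ => z * a ∈ Submodule.span F _) ?_ ?_ ?_ ?_ hz
    · rintro _ ⟨x, hx, y, hy, rfl⟩
      rw [hA.right_comm]
      exact Submodule.subset_span ⟨_, I.mul_mem_right a hx, y, hy, rfl⟩
    · rw [zero_mul]
      exact Submodule.zero_mem _
    · intro x y _ _ hx hy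
      rw [add_mul]
      exact Submodule.add_mem _ hx hy
    · intro c x _ hx
      rw [smul_mul_assoc]
      exact Submodule.smul_mem _ c hx

/-- The commutator ideal `[I, I]` of an ideal of a Novikov algebra. -/
def commutator [IsScalarTower F A A] [SMulCommClass F A A] (hF : (2 : F) ≠ 0) (hA : IsNovikov A)
    (I : AlgIdeal F A) : AlgIdeal F A :=
  have hr (a : A) {z : A} (hz : z ∈ Submodule.span F
      {z | ∃ x ∈ I.toSubmodule, ∃ y ∈ I.toSubmodule, z = x * y - y * x}) :
      z * a ∈ Submodule.span F
        {z | ∃ x ∈ I.toSubmodule, ∃ y ∈ I.toSubmodule, z = x * y - y * x} := by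
    refine Submodule.span_induction (p := fun z _ => z * a ∈ Submodule.span F _) ?_ ?_ ?_ ?_ hz
    · rintro _ ⟨x, hx, y, hy, rfl⟩
      rw [← Submodule.smul_mem_iff _ hF, two_smul, hA.commutator_mul_add_self]
      exact Submodule.sub_mem _
        (Submodule.subset_span ⟨_, I.mul_mem_right a hx, y, hy, rfl⟩)
        (Submodule.subset_span ⟨_, I.mul_mem_right a hy, x, hx, rfl⟩)
    · rw [zero_mul]
      exact Submodule.zero_mem _
    · intro x y _ _ hx hy
      rw [add_mul]
      exact Submodule.add_mem _ hx hy
    · intro c x _ hx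
      rw [smul_mul_assoc]
      exact Submodule.smul_mem _ c hx
  { toSubmodule := Submodule.span F
      {z | ∃ x ∈ I.toSubmodule, ∃ y ∈ I.toSubmodule, z = x * y - y * x}
    mul_mem_left := fun a z hz => by
      refine Submodule.span_induction (p := fun z _ => a * z ∈ Submodule.span F _) ?_ ?_ ?_ ?_ hz
      · rintro _ ⟨x, hx, y, hy, rfl⟩
        -- The Jacobi identity treats `[a, [x, y]]`; the remaining `[x, y] a` is covered by `hr`.
        rw [← sub_add_cancel (a * (x * y - y * x)) ((x * y - y * x) * a), hA.jacobi]
        exact Submodule.add_mem _ (Submodule.add_mem _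
          (Submodule.subset_span ⟨_, I.toSubmodule.sub_mem (I.mul_mem_left a hx)
            (I.mul_mem_right a hx), y, hy, rfl⟩)
          (Submodule.subset_span ⟨x, hx, _, I.toSubmodule.sub_mem (I.mul_mem_left a hy)
            (I.mul_mem_right a hy), rfl⟩))
          (hr a (Submodule.subset_span ⟨x, hx, y, hy, rfl⟩))
      · rw [mul_zero]
        exact Submodule.zero_mem _
      · intro x y _ _ hx hy
        rw [mul_add]
        exact Submodule.add_mem _ hx hy
      · intro c x _ hx
        rw [mul_smul_comm]
        exact Submodule.smul_mem _ c hx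
    mul_mem_right := fun a _ hz => hr a hz }

/-- An ideal inside `[A, A]` that is commutative modulo a semiprime ideal `B` lies in `B`. -/
theorem IsSemiprime.le_of_commutator_le [IsScalarTower F A A] [SMulCommClass F A A]
    (hA : IsNovikov A) {B : AlgIdeal F A} (hB : B.IsSemiprime) (K : AlgIdeal F A)
    (hK : K.toSubmodule ≤ lieSeries F A 1)
    (hc : ∀ x ∈ K.toSubmodule, ∀ y ∈ K.toSubmodule, x * y - y * x ∈ B.toSubmodule) :
    K.toSubmodule ≤ B.toSubmodule := by
  -- By right commutativity `(a, b, u) = [a, b] u - [a, b u]`, and both commutators are taken inside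
  -- `K`.
  have hass : ∀ a ∈ K.toSubmodule, ∀ b ∈ K.toSubmodule, ∀ u : A,
      associator a b u ∈ B.toSubmodule := by
    intro a ha b hb u
    have h1 := hc a ha (b * u) (K.mul_mem_right u hb)
    have h2 := B.mul_mem_right u (hc a ha b hb)
    have h3 := B.toSubmodule.sub_mem h2 h1
    rw [hA.right_comm b u a] at h3
    convert h3 using 1
    rw [associator_apply, sub_mul]
    abel
  have hprod : ∀ a ∈ K.toSubmodule, ∀ b ∈ K.toSubmodule, ∀ k ∈ K.toSubmodule,
      (b * a) * k ∈ B.toSubmodule := by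
    intro a ha b hb k hk
    -- `(b a, u, v) = (b, u, v) a = (u, b, v) a = (u a, b, v)`, whose first two entries lie in `K`.
    -- Then `(b a) [u, v] = (b a, v, u) - (b a, u, v)` is in `B`, and such commutators span a space
    -- containing `K`.
    have hass' : ∀ u v : A, associator (b * a) u v ∈ B.toSubmodule := by
      intro u v
      rw [hA.associator_mul, hA.left_symm, ← hA.associator_mul]
      exact hass _ (K.mul_mem_left u ha) b hb v
    refine Submodule.span_induction (p := fun z _ => (b * a) * z ∈ B.toSubmodule) ?_ ?_ ?_ ?_
      (hK hk)
    · rintro _ ⟨u, -, v, -, rfl⟩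
      have h := B.toSubmodule.sub_mem (hass' v u) (hass' u v)
      rw [associator_apply, associator_apply, hA.right_comm (b * a) v u,
        sub_sub_sub_cancel_left] at h
      rwa [mul_sub]
    · rw [mul_zero]
      exact Submodule.zero_mem _
    · intro x y _ _ hx hy
      rw [mul_add]
      exact Submodule.add_mem _ hx hy
    · intro c x _ hx
      rw [mul_smul_comm]
      exact Submodule.smul_mem _ c hx
  have hsq : (K.square hA).toSubmodule ≤ K.toSubmodule := by
    refine Submodule.span_le.2 ?_
    rintro _ ⟨x, _, y, hy, rfl⟩
    exact K.mul_mem_left x hy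
  -- Semiprimeness is used twice: `(K²)² ⊆ K² K ⊆ B` gives `K² ⊆ B`, then `K ⊆ B`.
  refine hB K fun x hx y hy => hB (K.square hA) ?_ (Submodule.subset_span ⟨x, hx, y, hy, rfl⟩)
  intro z hz w hw
  refine Submodule.span_induction (p := fun z _ => z * w ∈ B.toSubmodule) ?_ ?_ ?_ ?_ hz
  · rintro _ ⟨b, hb, a, ha, rfl⟩
    exact hprod a ha b hb w (hsq hw)
  · rw [zero_mul]
    exact Submodule.zero_mem _
  · intro x y _ _ hx hy
    rw [add_mul]
    exact Submodule.add_mem _ hx hy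
  · intro c x _ hx
    rw [smul_mul_assoc]
    exact Submodule.smul_mem _ c hx

theorem exists_eq_lieSeries [IsScalarTower F A A] [SMulCommClass F A A] (hF : (2 : F) ≠ 0)
    (hA : IsNovikov A) (n : ℕ) : ∃ I : AlgIdeal F A, I.toSubmodule = lieSeries F A n := by
  induction n with
  | zero => exact ⟨⟨⊤, fun _ _ _ => trivial, fun _ _ _ => trivial⟩, rfl⟩
  | succ n ih =>
    obtain ⟨I, hI⟩ := ih
    refine ⟨I.commutator hF hA, ?_⟩
    rw [lieSeries, ← hI]
    rfl

theorem lieSeries_succ_le_one (n : ℕ) : lieSeries F A (n + 1) ≤ lieSeries F A 1 := by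
  refine Submodule.span_mono ?_
  rintro _ ⟨x, _, y, _, rfl⟩
  exact ⟨x, trivial, y, trivial, rfl⟩

/-- A Lie-solvable Novikov algebra is commutative modulo every semiprime ideal. -/
theorem IsSemiprime.commutator_mem [IsScalarTower F A A] [SMulCommClass F A A]
    (hF : (2 : F) ≠ 0) (hA : IsNovikov A) (hL : IsLieSolvable F A) {B : AlgIdeal F A}
    (hB : B.IsSemiprime) (x y : A) : x * y - y * x ∈ B.toSubmodule := by
  -- The descent of the index stops at 1, as the previous argument needs an ideal inside `[A, A]`.
  have key : ∀ n, lieSeries F A (n + 1) ≤ B.toSubmodule → lieSeries F A 1 ≤ B.toSubmodule := by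
    intro n
    induction n with
    | zero => exact id
    | succ n ih =>
      intro h
      obtain ⟨K, hK⟩ := exists_eq_lieSeries (A := A) hF hA (n + 1)
      refine ih (hK ▸ hB.le_of_commutator_le hA K (hK ▸ lieSeries_succ_le_one n) ?_)
      intro x hx y hy
      exact h (Submodule.subset_span ⟨x, hK ▸ hx, y, hK ▸ hy, rfl⟩)
  obtain ⟨n, hn⟩ := hL
  refine key n ?_ (Submodule.subset_span ⟨x, trivial, y, trivial, rfl⟩)
  refine Submodule.span_le.2 ?_
  rintro _ ⟨x, hx, y, _, rfl⟩
  rw [hn, Submodule.mem_bot] at hx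
  rw [hx, zero_mul, mul_zero, sub_zero]
  exact Submodule.zero_mem _

theorem IsSemiprime.mem_of_mul_self_mem [IsScalarTower F A A] [SMulCommClass F A A]
    (hA : IsNovikov A) {B : AlgIdeal F A} (hB : B.IsSemiprime)
    (hc : ∀ x y : A, x * y - y * x ∈ B.toSubmodule) {y : A} (hy : y * y ∈ B.toSubmodule) :
    y ∈ B.toSubmodule := by
  have comm {a b : A} (h : a * b ∈ B.toSubmodule) : b * a ∈ B.toSubmodule := by
    have := B.toSubmodule.sub_mem h (hc a b)
    rwa [sub_sub_cancel] at this
  -- Modulo `B`, this is the annihilator of the annihilator of `y`. It contains `y` by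
  -- commutativity; as `y` annihilates itself, `I` annihilates `y`, so `I * I ⊆ B`.
  let I : AlgIdeal F A :=
    { carrier := {z | ∀ w, w * y ∈ B.toSubmodule → z * w ∈ B.toSubmodule}
      zero_mem' := fun w _ => by
        rw [zero_mul]
        exact Submodule.zero_mem _
      add_mem' := fun {a b} ha hb w hw => by
        rw [add_mul]
        exact Submodule.add_mem _ (ha w hw) (hb w hw)
      smul_mem' := fun c a ha w hw => by
        rw [smul_mul_assoc]
        exact Submodule.smul_mem _ c (ha w hw)
      mul_mem_left := fun a z hz w hw => by
        have h := B.toSubmodule.add_mem (B.mul_mem_right w (hc a z))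
          (B.mul_mem_right a (hz w hw))
        rwa [hA.right_comm z w a, sub_mul, sub_add_cancel] at h
      mul_mem_right := fun a z hz w hw => by
        rw [hA.right_comm]
        exact B.mul_mem_right a (hz w hw) }
  refine hB I ?_ (fun w hw => comm hw : y ∈ I.toSubmodule)
  intro a ha b hb
  exact ha b (hb y hy)

theorem IsSemiprime.mem_of_leftPow_mem [IsScalarTower F A A] [SMulCommClass F A A]
    (hA : IsNovikov A) {B : AlgIdeal F A} (hB : B.IsSemiprime)
    (hc : ∀ x y : A, x * y - y * x ∈ B.toSubmodule) (x : A) {n : ℕ} (hn : 0 < n)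
    (hx : leftPow x n ∈ B.toSubmodule) : x ∈ B.toSubmodule := by
  induction n, hn using Nat.le_induction with
  | base => exact hx
  | succ n hn ih =>
    refine ih (hB.mem_of_mul_self_mem hA hc ?_)
    rw [leftPow_succ x hn] at hx
    -- For `n = 1` there is no meaningful `x ^ (n - 1)`, but `x ^ 2` is already the required square.
    rcases hn.eq_or_lt with rfl | hn
    · exact hx
    obtain ⟨m, hm, rfl⟩ : ∃ m, 0 < m ∧ n = m + 1 := ⟨n - 1, by omega, by omega⟩
    set y := leftPow x (m + 1) with hy
    set z := leftPow x m
    have hyz : y = z * x := leftPow_succ x hm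
    -- Modulo `B`: `y y = (z x) y ≡ (x z) y = (x y) z ≡ (y x) z ≡ 0`.
    have h1 := B.mul_mem_right y (hc z x)
    have h2 := B.mul_mem_right z (hc x y)
    have h3 := B.mul_mem_right z hx
    have h4 := B.toSubmodule.add_mem h1 (B.toSubmodule.add_mem h2 h3)
    rw [sub_mul, sub_mul, hA.right_comm x z y, sub_add_cancel, sub_add_cancel, ← hyz] at h4
    exact h4

end AlgIdeal

/-! ### Stabilization of the Baer series and semiprimeness of the radical. -/

section Baer

universe u v

variable {F : Type u} {A : Type v} [Field F] [NonUnitalNonAssocRing A] [Module F A]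

/-- In a Novikov algebra, an element with a power in the Baer series is nilpotent. -/
theorem exists_leftPow_eq_zero_of_mem_baerSeries (hA : IsNovikov A) (α : Ordinal.{v}) (x : A)
    {n : ℕ} (hn : 0 < n) (hx : leftPow x n ∈ (baerSeries F A α).toSubmodule) :
    ∃ m, 0 < m ∧ leftPow x m = 0 := by
  induction α using Ordinal.limitRecOn generalizing n with
  | zero =>
    rw [baerSeries_zero] at hx
    exact ⟨n, hn, hx⟩
  | add_one α ih =>
    rw [baerSeries_add_one] at hx
    replace hx : (Submodule.Quotient.mk (leftPow x n) : A ⧸ (baerSeries F A α).toSubmodule) ∈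
      (AlgIdeal.sumTrivial F (A ⧸ (baerSeries F A α).toSubmodule)).toSubmodule := hx
    rw [AlgIdeal.mk_leftPow _ x hn] at hx
    obtain ⟨m, hm, h⟩ := AlgIdeal.exists_leftPow_eq_zero_of_mem_sumTrivial
      (AlgIdeal.isNovikov_quotient hA _) _ hn hx
    rw [← AlgIdeal.mk_leftPow _ x hm, Submodule.Quotient.mk_eq_zero] at h
    exact ih hm h
  | limit α hα ih =>
    obtain ⟨β, hβ, h⟩ := (mem_baerSeries_limit F A α hα _).1 hx
    exact ih β hβ hn h

/-- The Baer series is constant from some ordinal below that defining the Baer radical on. -/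
theorem exists_baerSeries_add_one_le :
    ∃ α < (Order.succ (Cardinal.mk A)).ord,
      (baerSeries F A (α + 1)).toSubmodule ≤ (baerSeries F A α).toSubmodule := by
  by_contra! h
  -- If every step were strict, choosing a new element at each one would inject an ordinal of
  -- cardinality greater than `|A|` into `A`.
  choose f hf hf' using fun α : Set.Iio (Order.succ (Cardinal.mk A)).ord =>
    SetLike.not_le_iff_exists.1 (h α.1 α.2)
  have hinj : Function.Injective f := by
    intro α β hαβ
    by_contra hne
    rcases lt_or_gt_of_ne hne with hlt | hlt
    · exact hf' β (baerSeries_mono F A (Order.add_one_le_of_lt hlt) (hαβ ▸ hf α))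
    · exact hf' α (baerSeries_mono F A (Order.add_one_le_of_lt hlt) (hαβ ▸ hf β))
  -- The ordinals below a bound form a type one universe above `A`, hence the `ULift`.
  have h1 := Cardinal.mk_le_of_injective
    (f := fun α : Set.Iio (Order.succ (Cardinal.mk A)).ord => ULift.up.{v + 1} (f α))
    (fun α β hαβ => hinj (ULift.up_injective hαβ))
  rw [Cardinal.mk_uLift, Cardinal.mk_Iio_ordinal, Cardinal.card_ord, Cardinal.lift_le] at h1
  exact (Order.lt_succ (Cardinal.mk A)).not_ge h1

theorem baerSeries_le_of_add_one_le {α : Ordinal.{v}}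
    (h : (baerSeries F A (α + 1)).toSubmodule ≤ (baerSeries F A α).toSubmodule)
    (β : Ordinal.{v}) :
    (baerSeries F A β).toSubmodule ≤ (baerSeries F A α).toSubmodule := by
  induction β using Ordinal.limitRecOn with
  | zero => exact baerSeries_mono F A zero_le
  | add_one β ih =>
    rcases le_total β α with hβ | hβ
    · exact (baerSeries_mono F A (add_le_add_left hβ 1)).trans h
    · have : baerSeries F A β = baerSeries F A α := by
        have e := le_antisymm ih (baerSeries_mono F A hβ)
        cases hb : baerSeries F A β
        cases ha : baerSeries F A α
        simp_all
      rw [baerSeries_add_one] at h ⊢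
      rwa [this]
  | limit β hβ ih =>
    intro x hx
    obtain ⟨γ, hγ, hx⟩ := (mem_baerSeries_limit F A β hβ x).1 hx
    exact ih γ hγ hx

/-- An ideal whose square lies in the radical appears at the next stage of the series, which adds
nothing after stabilization. -/
theorem isSemiprime_baerRadical : (baerRadical F A).IsSemiprime := by
  obtain ⟨α, hα, h⟩ := exists_baerSeries_add_one_le (F := F) (A := A)
  intro I hI
  have hle := AlgIdeal.le_preimage_sumTrivial (baerRadical F A) I hI
  rw [baerRadical, ← baerSeries_add_one] at hle
  exact (hle.trans (baerSeries_le_of_add_one_le h _)).trans (baerSeries_mono F A hα.le)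

end Baer

end NonAssocAlg

theorem lemma4 {F : Type*} {A : Type*} [Field F] [NonUnitalNonAssocRing A] [Module F A]
    [IsScalarTower F A A] [SMulCommClass F A A] (hF : (2 : F) ≠ 0)
    (hA : IsNovikov A) (hL : NonAssocAlg.IsLieSolvable F A) :
    ((NonAssocAlg.baerRadical F A).toSubmodule : Set A) =
      {x : A | ∃ n : ℕ, 0 < n ∧ NonAssocAlg.leftPow x n = 0} := by
  ext x
  constructor
  · intro hx
    exact NonAssocAlg.exists_leftPow_eq_zero_of_mem_baerSeries hA _ x one_pos hx
  · rintro ⟨n, hn, hx⟩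
    have hB := NonAssocAlg.isSemiprime_baerRadical (F := F) (A := A)
    refine hB.mem_of_leftPow_mem hA (hB.commutator_mem hF hA hL) x hn ?_
    rw [hx]
    exact Submodule.zero_mem _
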